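/- Graphs are finite and may have loops and parallel edges. For a graph $H$ let $\Delta H=|E(H)|-|V(H)|$. A \emph{cacti-graph} is a graph with no isolated vertices, no leaves and no component that is a cycle (a loop counts as a cycle with one edge, and contributes two to the degree of its vertex). For a graph $G$ and $X\subseteq E(G)$ let $G\langle X\rangle$ be the subgraph whose edges are the members of $X$ and whose vertices are their ends. For an integer $k\ge 1$, the $k$-circular matroid $M_k(G)$ is the matroid on $E(G)$ whose circuits are the sets $C\subseteq E(G)$ such that $\Delta(G\langle C\rangle)=k$ and $G\langle C\rangle$ is a cacti-graph; $\rho^*_k(G)$ denotes its corank, i.e. the rank of its dual. A matroid is called connected if it has no loops, no coloops, and every two of its elements belong to a common circuit. For a vertex $x$ of $G$ let $S(x,G)$ be the set of edges incident to $x$ and $s(x,G)=|S(x,G)|$. \textbf{Theorem.} Let $G$ be a finite graph without isolated vertices, let $k\ge 1$, and let $x$ be a vertex of $G$. Suppose that $M_k(G)$ is a connected matroid and that $s(x,G)\le \rho^*_k(G)+1$ (i.e. $x$ is not $k$-big). Then $S(x,G)$ is a cocircuit of $M_k(G)$ if and only if $G\setminus x$ (the graph obtained by deleting the vertex $x$ and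 all edges incident to it) has no component that is a tree, where an isolated vertex counts as a tree. -/

import Mathlib

namespace KCircular

/-! ### Finite multigraphs (loops and parallel edges allowed) -/

/-- `G⟨X⟩`: the subgraph of `G` induced by a set `X` of edges. Its edges are the members of `X` and
its vertices are their ends. -/
def edgeInduce {α β : Type*} (G : Graph α β) (X : Set β) : Graph α β :=
  (G.restrict X).induce {v | ∃ e ∈ X, G.Inc e v}

/-- `Δ G = |E(G)| - |V(G)|`, for a finite graph `G`. -/
noncomputable def excess {α β : Type*} (G : Graph α β) : ℤ :=
  (G.edgeSet.ncard : ℤ) - (G.vertexSet.ncard : ℤ)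

/-- The degree of a vertex of a finite graph; a loop counts twice. -/
noncomputable def degree {α β : Type*} (G : Graph α β) (v : α) : ℕ :=
  ({e | G.Inc e v} : Set β).ncard + ({e | G.IsLoopAt e v} : Set β).ncard

/-- The vertex star `S(v, G)`: the set of edges of `G` incident to `v`. -/
def star {α β : Type*} (G : Graph α β) (v : α) : Set β :=
  {e | G.Inc e v}

/-- A graph is connected if it has a vertex and any two vertices are joined by a walk. -/
def Connected {α β : Type*} (G : Graph α β) : Prop :=
  G.vertexSet.Nonempty ∧
    ∀ u ∈ G.vertexSet, ∀ v ∈ G.vertexSet, Relation.ReflTransGen G.Adj u v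

/-- `A` is a (connected) component of `G`: a connected subgraph that contains every edge of `G`
incident to one of its vertices. -/
def IsComponent {α β : Type*} (A G : Graph α β) : Prop :=
  A.IsClosedSubgraph G ∧ Connected A

/-- A finite graph is a cycle if it is connected and every vertex has degree two. A vertex with a
loop is a cycle with one edge; two parallel edges form a cycle with two edges. -/
def IsCycle {α β : Type*} (G : Graph α β) : Prop :=
  Connected G ∧ ∀ v ∈ G.vertexSet, degree G v = 2

/-- A tree is a connected graph without cycles. An isolated vertex is a tree. -/
def IsTree {α β : Type*} (G : Graph α β) : Prop :=
  Connected G ∧ ∀ C ≤ G, ¬ IsCycle C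

/-- A cacti-graph: no isolated vertices, no leaves, and no cycle components. -/
def IsCactiGraph {α β : Type*} (G : Graph α β) : Prop :=
  (∀ v ∈ G.vertexSet, degree G v ≠ 0) ∧
  (∀ v ∈ G.vertexSet, degree G v ≠ 1) ∧
  (∀ A, IsComponent A G → ¬ IsCycle A)

/-- The family `𝒞_k(G)` of the `k`-circuits of `G`. -/
def circuits {α β : Type*} (G : Graph α β) (k : ℕ) : Set (Set β) :=
  {C | C ⊆ G.edgeSet ∧ excess (edgeInduce G C) = k ∧ IsCactiGraph (edgeInduce G C)}

/-! ### The family `𝒞_k(G)` is the family of circuits of a matroid -/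

section Facts

variable {α β : Type*} {G : Graph α β}

/-- The set of ends of the edges in `X`. -/
def ends (G : Graph α β) (X : Set β) : Set α := {v | ∃ e ∈ X, G.Inc e v}

lemma ends_mono {X Y : Set β} (h : X ⊆ Y) : ends G X ⊆ ends G Y :=
  fun _ ⟨e, he, hv⟩ ↦ ⟨e, h he, hv⟩

lemma ends_union (X Y : Set β) : ends G (X ∪ Y) = ends G X ∪ ends G Y := by
  ext v; simp only [ends, Set.mem_union, Set.mem_ofPred_eq]; grind

lemma ends_inter_subset (X Y : Set β) : ends G (X ∩ Y) ⊆ ends G X ∩ ends G Y :=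
  fun _ ⟨e, he, hv⟩ ↦ ⟨⟨e, he.1, hv⟩, ⟨e, he.2, hv⟩⟩

lemma finite_inc (e : β) : {v | G.Inc e v}.Finite := by
  by_cases he : e ∈ G.edgeSet
  · obtain ⟨a, b, hab⟩ := G.exists_isLink_of_mem_edgeSet he
    refine (Set.toFinite {a, b}).subset fun v hv ↦ ?_
    exact hv.eq_or_eq_of_isLink hab
  · convert! Set.finite_empty
    ext v
    simpa using fun h : G.Inc e v ↦ he h.edge_mem

lemma finite_ends {X : Set β} (hX : X.Finite) : (ends G X).Finite := by
  have : ends G X = ⋃ e ∈ X, {v | G.Inc e v} := by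
    ext v; simp [ends]
  rw [this]
  exact hX.biUnion fun e _ ↦ finite_inc e

lemma edgeInduce_vertexSet (X : Set β) : (edgeInduce G X).vertexSet = ends G X := rfl

lemma edgeInduce_isLink {X : Set β} {e : β} {u v : α} :
    (edgeInduce G X).IsLink e u v ↔ e ∈ X ∧ G.IsLink e u v := by
  simp only [edgeInduce, Graph.induce_isLink, Graph.restrict_isLink, Set.mem_ofPred_eq]
  exact ⟨fun h ↦ h.1, fun h ↦ ⟨h, ⟨e, h.1, h.2.inc_left⟩, ⟨e, h.1, h.2.inc_right⟩⟩⟩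

lemma edgeInduce_inc {X : Set β} {e : β} {v : α} :
    (edgeInduce G X).Inc e v ↔ e ∈ X ∧ G.Inc e v := by
  simp [Graph.Inc, edgeInduce_isLink]

lemma edgeInduce_edgeSet {X : Set β} (hX : X ⊆ G.edgeSet) : (edgeInduce G X).edgeSet = X := by
  ext e
  rw [Graph.edge_mem_iff_exists_isLink]
  simp only [edgeInduce_isLink]
  refine ⟨fun ⟨_, _, h⟩ ↦ h.1, fun h ↦ ?_⟩
  obtain ⟨a, b, hab⟩ := G.exists_isLink_of_mem_edgeSet (hX h)
  exact ⟨a, b, h, hab⟩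

/-- The excess of a set of edges. -/
noncomputable def exc (G : Graph α β) (X : Set β) : ℤ := (X.ncard : ℤ) - (ends G X).ncard

lemma excess_edgeInduce {X : Set β} (hX : X ⊆ G.edgeSet) :
    excess (edgeInduce G X) = exc G X := by
  rw [excess, edgeInduce_edgeSet hX, edgeInduce_vertexSet, exc]

lemma exc_empty : exc G ∅ = 0 := by simp [exc, ends]

lemma exc_supermodular {X Y : Set β} (hX : X.Finite) (hY : Y.Finite) :
    exc G X + exc G Y ≤ exc G (X ∪ Y) + exc G (X ∩ Y) := by
  have h1 := Set.ncard_union_add_ncard_inter X Y hX hY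
  have h2 := Set.ncard_union_add_ncard_inter (ends G X) (ends G Y) (finite_ends hX) (finite_ends hY)
  have h3 := Set.ncard_le_ncard (ends_inter_subset (G := G) X Y)
    ((finite_ends hX).subset Set.inter_subset_left)
  simp only [exc, ends_union]
  zify at h1 h2 h3
  linarith

/-- Handshaking: in a finite graph the degrees in a set `U` of vertices count the incidences of
edges with `U`. -/
lemma sum_degree (hE : G.edgeSet.Finite) (a b : β → α)
    (hab : ∀ e ∈ G.edgeSet, G.IsLink e (a e) (b e)) (U : Finset α) :
    (∑ v ∈ U, degree G v) = ∑ e ∈ hE.toFinset,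
      ((open Classical in if a e ∈ U then 1 else 0) +
        (open Classical in if b e ∈ U then 1 else 0)) := by
  classical
  have hd : ∀ v, degree G v = ∑ e ∈ hE.toFinset,
      ((if a e = v then 1 else 0) + (if b e = v then 1 else 0)) := by
    intro v
    have hi : {e | G.Inc e v} = ↑(hE.toFinset.filter fun e ↦ G.Inc e v) := by
      ext e; simp only [Set.mem_ofPred_eq, Finset.coe_filter, Set.Finite.mem_toFinset,
        Set.mem_ofPred_eq]
      exact ⟨fun h ↦ ⟨h.edge_mem, h⟩, fun h ↦ h.2⟩
    have hl : {e | G.IsLoopAt e v} = ↑(hE.toFinset.filter fun e ↦ G.IsLoopAt e v) := by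
      ext e; simp only [Set.mem_ofPred_eq, Finset.coe_filter, Set.Finite.mem_toFinset,
        Set.mem_ofPred_eq]
      exact ⟨fun h ↦ ⟨h.edge_mem, h⟩, fun h ↦ h.2⟩
    rw [degree, hi, hl, Set.ncard_coe_finset, Set.ncard_coe_finset, Finset.card_filter,
      Finset.card_filter, ← Finset.sum_add_distrib]
    refine Finset.sum_congr rfl fun e he ↦ ?_
    have h := hab e (by simpa using he)
    have h1 : G.Inc e v ↔ a e = v ∨ b e = v := by
      constructor
      · intro h'
        rcases h'.eq_or_eq_of_isLink h with h'' | h''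
        · exact Or.inl h''.symm
        · exact Or.inr h''.symm
      · rintro (rfl | rfl)
        · exact h.inc_left
        · exact h.inc_right
    have h2 : G.IsLoopAt e v ↔ a e = v ∧ b e = v := by
      rw [← Graph.isLink_self_iff, h.isLink_iff]; tauto
    rw [if_congr h1 rfl rfl, if_congr h2 rfl rfl]
    by_cases p : a e = v <;> by_cases q : b e = v <;> simp [p, q]
  simp_rw [hd]
  rw [Finset.sum_comm]
  refine Finset.sum_congr rfl fun e _ ↦ ?_
  rw [Finset.sum_add_distrib, Finset.sum_ite_eq, Finset.sum_ite_eq]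

lemma exists_ends (G : Graph α β) [Nonempty α] : ∃ a b : β → α,
    ∀ e ∈ G.edgeSet, G.IsLink e (a e) (b e) := by
  classical
  have : ∀ e, ∃ p : α × α, e ∈ G.edgeSet → G.IsLink e p.1 p.2 := by
    intro e
    by_cases he : e ∈ G.edgeSet
    · obtain ⟨a, b, h⟩ := G.exists_isLink_of_mem_edgeSet he
      exact ⟨(a, b), fun _ ↦ h⟩
    · exact ⟨Classical.arbitrary _, fun h ↦ absurd h he⟩
  choose p hp using this
  exact ⟨fun e ↦ (p e).1, fun e ↦ (p e).2, hp⟩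

lemma IsCycle.card_eq {A : Graph α β} (hA : IsCycle A) (hE : A.edgeSet.Finite)
    (hV : A.vertexSet.Finite) : A.edgeSet.ncard = A.vertexSet.ncard := by
  classical
  obtain ⟨v, -⟩ := hA.1.1
  have : Nonempty α := ⟨v⟩
  obtain ⟨a, b, hab⟩ := exists_ends A
  have h := sum_degree hE a b hab hV.toFinset
  rw [Finset.sum_congr rfl (g := fun _ ↦ 2) (fun v hv ↦ hA.2 v (by simpa using hv)),
    Finset.sum_congr (s₁ := hE.toFinset) rfl (g := fun _ ↦ 2) (fun e he ↦ by
      have h := hab e (by simpa using he)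
      simp [h.left_mem, h.right_mem])] at h
  rw [Set.ncard_eq_toFinset_card _ hE, Set.ncard_eq_toFinset_card _ hV]
  simp only [Finset.sum_const, smul_eq_mul] at h
  omega

lemma exists_circuit_subset {k : ℕ} (hk : 1 ≤ k) {X : Set β} (hX : X ⊆ G.edgeSet)
    (hfin : X.Finite) (h : (k : ℤ) ≤ exc G X) : ∃ C ⊆ X, C ∈ circuits G k := by
  classical
  obtain ⟨Y, hYX, hYmin⟩ := (hfin.finite_subsets.subset
    (s := {Y | Y ⊆ X} ) (t := {Y | Y ⊆ X ∧ (k : ℤ) ≤ exc G Y}) (fun _ h ↦ h.1)).exists_le_minimal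
      (a := X) ⟨subset_rfl, h⟩
  have hY := hYmin.prop.2
  have hYfin : Y.Finite := hfin.subset hYX
  have hYE : Y ⊆ G.edgeSet := hYX.trans hX
  have hmin : ∀ Z ⊆ Y, Z ≠ Y → exc G Z < k := by
    intro Z hZ hne
    by_contra! hc
    exact hne (hZ.antisymm (hYmin.le_of_le ⟨hZ.trans hYX, hc⟩ hZ))
  have hsub : ∀ e, ends G (Y \ {e}) ⊆ ends G Y := fun e ↦ ends_mono Set.sdiff_subset
  refine ⟨Y, hYX, hYE, ?_, ?_, ?_, ?_⟩
  · rw [excess_edgeInduce hYE]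
    refine le_antisymm ?_ hY
    obtain ⟨e, he⟩ : Y.Nonempty := by
      rw [Set.nonempty_iff_ne_empty]
      rintro rfl
      rw [exc_empty] at hY
      omega
    have h1 := hmin (Y \ {e}) Set.sdiff_subset (fun h ↦ by rw [← h] at he; exact he.2 rfl)
    have h2 := Set.ncard_sdiff_singleton_add_one he hYfin
    have h3 := Set.ncard_le_ncard (hsub e) (finite_ends hYfin)
    simp only [exc] at h1 ⊢
    omega
  · rintro v ⟨e, he, hv⟩ h0
    have : {e | (edgeInduce G Y).Inc e v} = ∅ := by
      have hf : ({e | (edgeInduce G Y).Inc e v}).Finite :=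
        hYfin.subset fun e he ↦ (edgeInduce_inc.1 he).1
      rw [← Set.ncard_eq_zero hf]
      simp only [degree] at h0
      omega
    exact absurd (show e ∈ {e | (edgeInduce G Y).Inc e v} from edgeInduce_inc.2 ⟨he, hv⟩)
      (by simp [this])
  · rintro v ⟨e, he, hv⟩ h1
    have hf : ({e | (edgeInduce G Y).Inc e v}).Finite :=
      hYfin.subset fun e he ↦ (edgeInduce_inc.1 he).1
    have hle : ({e | (edgeInduce G Y).Inc e v}).ncard ≤ 1 := by
      simp only [degree] at h1
      omega
    have huniq : ∀ f ∈ Y, G.Inc f v → f = e := fun f hf' hfv ↦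
      (Set.ncard_le_one hf).1 hle f (edgeInduce_inc.2 ⟨hf', hfv⟩) e (edgeInduce_inc.2 ⟨he, hv⟩)
    have h1 := hmin (Y \ {e}) Set.sdiff_subset (fun h ↦ by rw [← h] at he; exact he.2 rfl)
    have h2 := Set.ncard_sdiff_singleton_add_one he hYfin
    have h3 : (ends G (Y \ {e})).ncard < (ends G Y).ncard := by
      refine Set.ncard_lt_ncard ⟨hsub e, fun hc ↦ ?_⟩ (finite_ends hYfin)
      obtain ⟨f, hf', hfv⟩ := hc ⟨e, he, hv⟩
      exact hf'.2 (huniq f hf'.1 hfv)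
    simp only [exc] at h1 hY
    omega
  · intro A hA hcyc
    have hAE : A.edgeSet ⊆ Y := by
      have := hA.1.le.edgeSet_mono
      rwa [edgeInduce_edgeSet hYE] at this
    have hAV : A.vertexSet ⊆ ends G Y := hA.1.le.vertexSet_mono
    have hcard := hcyc.card_eq (hYfin.subset hAE) ((finite_ends hYfin).subset hAV)
    obtain ⟨v, hv⟩ := hcyc.1.1
    have hclosed : ∀ e ∈ Y, ∀ u ∈ A.vertexSet, G.Inc e u → e ∈ A.edgeSet := fun e he u hu h ↦
      hA.1.closed (edgeInduce_inc.2 ⟨he, h⟩) hu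
    have hne : Y \ A.edgeSet ≠ Y := by
      intro hc
      obtain ⟨e, he, hev⟩ := hAV hv
      have h' := hclosed e he v hv hev
      rw [← hc] at he
      exact he.2 h'
    have h1 := hmin _ Set.sdiff_subset hne
    have h2 := Set.ncard_sdiff_add_ncard_of_subset hAE hYfin
    have h3 : (ends G (Y \ A.edgeSet)).ncard ≤ (ends G Y \ A.vertexSet).ncard := by
      refine Set.ncard_le_ncard ?_ ((finite_ends hYfin).subset Set.sdiff_subset)
      rintro u ⟨e, he, heu⟩
      exact ⟨⟨e, he.1, heu⟩, fun hu ↦ he.2 (hclosed e he.1 u hu heu)⟩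
    have h4 := Set.ncard_sdiff_add_ncard_of_subset hAV (finite_ends hYfin)
    simp only [exc] at h1 hY
    omega

/-- A set of edges of `G` contains no `k`-circuit if and only if each of its subsets has excess
less than `k`. -/
lemma noCircuit_iff {k : ℕ} (hk : 1 ≤ k) {I : Set β} (hI : I ⊆ G.edgeSet) (hfin : I.Finite) :
    (∀ C ∈ circuits G k, ¬ C ⊆ I) ↔ ∀ Y ⊆ I, exc G Y < k := by
  constructor
  · intro h Y hY
    by_contra! hc
    obtain ⟨C, hCY, hC⟩ := exists_circuit_subset hk (hY.trans hI) (hfin.subset hY) hc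
    exact h C hC (hCY.trans hY)
  · intro h C hC hCI
    have := h C hCI
    rw [← excess_edgeInduce hC.1, hC.2.1] at this
    exact lt_irrefl _ this

lemma augment {k : ℕ} {I J : Set β} (hIf : I.Finite)
    (hJf : J.Finite) (hI : ∀ Y ⊆ I, exc G Y < k) (hJ : ∀ Y ⊆ J, exc G Y < k)
    (hcard : I.ncard < J.ncard) : ∃ e ∈ J, e ∉ I ∧ ∀ Y ⊆ insert e I, exc G Y < k := by
  classical
  by_contra! hcon
  -- every element of `J \ I` is spanned by a tight subset of `I`
  have htight : ∀ e ∈ J \ I, ∃ Y ⊆ I, exc G Y = k - 1 ∧ ends G {e} ⊆ ends G Y := by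
    intro e he
    obtain ⟨Y, hY, hYk⟩ := hcon e he.1 he.2
    have heY : e ∈ Y := by
      by_contra h
      have := hI Y ((Set.subset_insert_iff_of_notMem h).1 hY)
      omega
    have hYf : Y.Finite := (hIf.insert e).subset hY
    have hsub : Y \ {e} ⊆ I := by
      intro f hf
      exact (hY hf.1).resolve_left hf.2
    have h1 := hI _ hsub
    have h2 := Set.ncard_sdiff_singleton_add_one heY hYf
    have hm : ends G (Y \ {e}) ⊆ ends G Y := ends_mono Set.sdiff_subset
    have h3 := Set.ncard_le_ncard hm (finite_ends hYf)
    simp only [exc] at h1 hYk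
    refine ⟨Y \ {e}, hsub, by simp only [exc]; omega, ?_⟩
    have h4 : ends G (Y \ {e}) = ends G Y :=
      Set.eq_of_subset_of_ncard_le hm (by omega) (finite_ends hYf)
    rw [h4]
    exact ends_mono (by simpa using heY)
  -- tight sets are closed under union
  have hunion : ∀ D : Set β, D.Finite → D ⊆ J \ I → D.Nonempty →
      ∃ T ⊆ I, exc G T = k - 1 ∧ ends G D ⊆ ends G T := by
    intro D hD
    induction D, hD using Set.Finite.induction_on with
    | empty => intro _ h; exact absurd h Set.not_nonempty_empty
    | @insert e D _ _ ih =>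
      intro hDJ _
      obtain ⟨Y, hYI, hYk, hYe⟩ := htight e (hDJ (Set.mem_insert _ _))
      rcases D.eq_empty_or_nonempty with rfl | hne
      · exact ⟨Y, hYI, hYk, by simpa using hYe⟩
      · obtain ⟨T, hTI, hTk, hTD⟩ := ih ((Set.subset_insert _ _).trans hDJ) hne
        refine ⟨Y ∪ T, Set.union_subset hYI hTI, ?_, ?_⟩
        · have h1 := exc_supermodular (G := G) (hIf.subset hYI) (hIf.subset hTI)
          have h2 := hI _ (Set.union_subset hYI hTI)
          have h3 := hI (Y ∩ T) (Set.inter_subset_left.trans hYI)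
          omega
        · rw [Set.insert_eq, ends_union, ends_union]
          exact Set.union_subset_union hYe hTD
  have hne : (J \ I).Nonempty := by
    rw [Set.nonempty_iff_ne_empty]
    intro h
    rw [Set.sdiff_eq_empty] at h
    exact absurd (Set.ncard_le_ncard h hIf) (by omega)
  obtain ⟨T, hTI, hTk, hTD⟩ := hunion (J \ I) (hJf.subset Set.sdiff_subset) subset_rfl hne
  have hTf := hIf.subset hTI
  have h1 := hJ ((J ∩ T) ∪ (J \ I)) (Set.union_subset Set.inter_subset_left Set.sdiff_subset)
  have h2 : (ends G ((J ∩ T) ∪ (J \ I))).ncard ≤ (ends G T).ncard := by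
    refine Set.ncard_le_ncard ?_ (finite_ends hTf)
    rw [ends_union]
    exact Set.union_subset (ends_mono Set.inter_subset_right) hTD
  have h3 : ((J ∩ T) ∪ (J \ I)).ncard = (J ∩ T).ncard + (J \ I).ncard :=
    Set.ncard_union_eq (Set.disjoint_left.2 fun e he he' ↦ he'.2 (hTI he.2))
      (hJf.subset Set.inter_subset_left) (hJf.subset Set.sdiff_subset)
  have h4 : J.ncard ≤ ((J ∩ T) ∪ (J \ I)).ncard + (I \ T).ncard := by
    refine (Set.ncard_le_ncard ?_ ?_).trans (Set.ncard_union_le _ _)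
    · intro e he
      by_cases h1 : e ∈ I <;> by_cases h2 : e ∈ T <;> simp [h1, h2, he]
    · exact ((hJf.subset Set.inter_subset_left).union (hJf.subset Set.sdiff_subset)).union
        (hIf.subset Set.sdiff_subset)
  have h5 := Set.ncard_sdiff_add_ncard_of_subset hTI hIf
  simp only [exc] at h1 hTk
  omega

/-- Removing edges from a cacti-graph lowers the excess. -/
lemma exc_lt_of_ssubset {Y Z : Set β} (hYE : Y ⊆ G.edgeSet) (hYfin : Y.Finite)
    (hY : IsCactiGraph (edgeInduce G Y)) (hZ : Z ⊆ Y) (hne : Z ≠ Y) : exc G Z < exc G Y := by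
  classical
  by_contra! hcon
  set H := edgeInduce G Y with hH
  have hHE : H.edgeSet = Y := edgeInduce_edgeSet hYE
  obtain ⟨e₀, he₀Y, he₀Z⟩ : ∃ e ∈ Y, e ∉ Z := by
    by_contra! h
    exact hne (hZ.antisymm h)
  obtain ⟨a₀, b₀, -⟩ := G.exists_isLink_of_mem_edgeSet (hYE he₀Y)
  have : Nonempty α := ⟨a₀⟩
  obtain ⟨a, b, hab⟩ := exists_ends H
  have hEf : H.edgeSet.Finite := by rw [hHE]; exact hYfin
  have hUf : (ends G Y \ ends G Z).Finite := (finite_ends hYfin).subset Set.sdiff_subset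
  have hsum := sum_degree hEf a b hab hUf.toFinset
  set U := hUf.toFinset with hU
  have hmemU : ∀ v, v ∈ U ↔ v ∈ ends G Y ∧ v ∉ ends G Z := fun v ↦ by simp [hU]
  -- the degrees in `U` are at least two
  have hdeg : ∀ v ∈ U, 2 ≤ degree H v := by
    intro v hv
    have hv' : v ∈ H.vertexSet := ((hmemU v).1 hv).1
    have h0 := hY.1 v hv'
    have h1 := hY.2.1 v hv'
    omega
  -- the edges incident to `U` lie outside `Z`
  have hinc : ∀ e v, H.Inc e v → v ∈ U → e ∉ Z := fun e v he hv heZ ↦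
    ((hmemU v).1 hv).2 ⟨e, heZ, (edgeInduce_inc.1 he).2⟩
  have hbound : ∀ e ∈ hEf.toFinset, ((if a e ∈ U then 1 else 0) + (if b e ∈ U then 1 else 0)) ≤
      (if e ∉ Z then 2 else 0) := by
    intro e he
    have h := hab e (by simpa using he)
    by_cases h1 : a e ∈ U
    · have := hinc e _ h.inc_left h1
      rw [if_pos this]
      split_ifs <;> omega
    · by_cases h2 : b e ∈ U
      · have := hinc e _ h.inc_right h2
        rw [if_pos this]
        split_ifs; omega
      · simp [h1, h2]
  have hD : (∑ e ∈ hEf.toFinset, if e ∉ Z then 2 else 0) = 2 * (Y \ Z).ncard := by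
    have : (Y \ Z) = ↑(hEf.toFinset.filter fun e ↦ e ∉ Z) := by
      ext e; simp [hHE]
    rw [this, Set.ncard_coe_finset, ← Finset.sum_filter, Finset.sum_const, smul_eq_mul, mul_comm]
  have hcU : (ends G Y \ ends G Z).ncard = U.card := Set.ncard_eq_toFinset_card _ hUf
  have h1 := Set.ncard_sdiff_add_ncard_of_subset hZ hYfin
  have h2 := Set.ncard_sdiff_add_ncard_of_subset (ends_mono (G := G) hZ) (finite_ends hYfin)
  have hDU : (Y \ Z).ncard ≤ U.card := by
    simp only [exc] at hcon
    omega
  have hlow : (∑ _v ∈ U, 2) ≤ ∑ v ∈ U, degree H v := Finset.sum_le_sum hdeg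
  have hlow' : (∑ _v ∈ U, 2) = 2 * U.card := by rw [Finset.sum_const, smul_eq_mul, mul_comm]
  have hup := Finset.sum_le_sum hbound
  -- hence all the inequalities are equalities
  have hdeg2 : ∀ v ∈ U, degree H v = 2 := fun v hv ↦
    ((Finset.sum_eq_sum_iff_of_le hdeg).1 (by omega) v hv).symm
  have hboth : ∀ e ∈ Y, e ∉ Z → a e ∈ U ∧ b e ∈ U := by
    intro e he heZ
    have h := (Finset.sum_eq_sum_iff_of_le hbound).1 (by omega) e (by simpa [hHE] using he)
    rw [if_pos heZ] at h
    by_cases h1 : a e ∈ U <;> by_cases h2 : b e ∈ U <;> simp only [h1, h2, if_true, if_false] at h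
    · exact ⟨h1, h2⟩
    all_goals omega
  have hstep : ∀ v w, v ∈ U → H.Adj v w → w ∈ U := by
    rintro v w hv ⟨e, he⟩
    have heY : e ∈ Y := hHE ▸ he.edge_mem
    obtain ⟨h1, h2⟩ := hboth e heY (hinc e v he.inc_left hv)
    rcases he.inc_right.eq_or_eq_of_isLink (hab e he.edge_mem) with rfl | rfl
    · exact h1
    · exact h2
  -- the component of a vertex of `U` is a cycle
  have hu : a e₀ ∈ U := (hboth e₀ he₀Y he₀Z).1
  set u := a e₀ with hu_def
  set W : Set α := {w | Relation.ReflTransGen H.Adj u w} with hW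
  have hWU : ∀ w ∈ W, w ∈ U := by
    intro w hw
    induction hw with
    | refl => exact hu
    | tail _ h ih => exact hstep _ _ ih h
  have hWV : W ⊆ H.vertexSet := fun w hw ↦ ((hmemU w).1 (hWU w hw)).1
  have hWcl : ∀ e v w, H.IsLink e v w → v ∈ W → w ∈ W := fun e v w h hv ↦
    Relation.ReflTransGen.tail hv ⟨e, h⟩
  have hclosed : (H.induce W).IsClosedSubgraph H := by
    refine Graph.IsClosedSubgraph.mk' (Graph.induce_le hWV) ?_
    rintro e v ⟨w, h⟩ hv
    exact ⟨v, w, h, hv, hWcl e v w h hv⟩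
  have hconn : Connected (H.induce W) := by
    have hreach : ∀ w ∈ W, Relation.ReflTransGen (H.induce W).Adj u w := by
      intro w hw
      induction hw with
      | refl => exact Relation.ReflTransGen.refl
      | @tail v w hv h ih =>
        obtain ⟨e, he⟩ := h
        exact ih.tail ⟨e, he, hv, hWcl e v w he hv⟩
    refine ⟨⟨u, Relation.ReflTransGen.refl⟩, fun v hv w hw ↦ ?_⟩
    exact (Std.Symm.symm _ _ (hreach v hv)).trans (hreach w hw)
  refine hY.2.2 _ ⟨hclosed, hconn⟩ ⟨hconn, fun v hv ↦ ?_⟩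
  rw [← hdeg2 v (hWU v hv)]
  have hv' : v ∈ W := hv
  have h1 : {e | (H.induce W).Inc e v} = {e | H.Inc e v} := by
    ext e
    constructor
    · rintro ⟨w, h⟩
      exact ⟨w, h.1⟩
    · rintro ⟨w, h⟩
      exact ⟨w, h, hv', hWcl e v w h hv'⟩
  have h2 : {e | (H.induce W).IsLoopAt e v} = {e | H.IsLoopAt e v} := by
    ext e
    constructor
    · intro h
      exact h.1
    · intro h
      exact ⟨h, hv', hv'⟩
  rw [degree, degree, h1, h2]

end Facts

/-- The `k`-circular matroid `M_k(G)` of a finite graph `G`, for `k ≥ 1`: the matroid on `E(G)`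
whose independent sets are the sets of edges that contain no member of `𝒞_k(G)`. -/
def kCircularMatroid {α β : Type*} (G : Graph α β) (hE : G.edgeSet.Finite) (k : ℕ) (hk : 1 ≤ k) :
    Matroid β :=
  (IndepMatroid.ofFinite hE (fun I ↦ I ⊆ G.edgeSet ∧ ∀ C ∈ circuits G k, ¬ C ⊆ I)
    (by
      refine ⟨Set.empty_subset _, ?_⟩
      rw [noCircuit_iff hk (Set.empty_subset _) Set.finite_empty]
      intro Y hY
      rw [Set.subset_empty_iff.1 hY, exc_empty]
      omega)
    (fun _ _ hJ hIJ ↦ ⟨hIJ.trans hJ.1, fun C hC hCI ↦ hJ.2 C hC (hCI.trans hIJ)⟩)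
    (by
      rintro I J ⟨hIE, hI⟩ ⟨hJE, hJ⟩ hcard
      have hIf := hE.subset hIE
      have hJf := hE.subset hJE
      rw [noCircuit_iff hk hIE hIf] at hI
      rw [noCircuit_iff hk hJE hJf] at hJ
      obtain ⟨e, heJ, heI, h⟩ := augment hIf hJf hI hJ hcard
      have hsub : insert e I ⊆ G.edgeSet := Set.insert_subset (hJE heJ) hIE
      exact ⟨e, heJ, heI, hsub, (noCircuit_iff hk hsub (hIf.insert e)).2 h⟩)
    (fun _ h ↦ h.1)).matroid

lemma kCircularMatroid_indep_iff {α β : Type*} {G : Graph α β} {hE : G.edgeSet.Finite} {k : ℕ}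
    {hk : 1 ≤ k} {I : Set β} : (kCircularMatroid G hE k hk).Indep I ↔
      I ⊆ G.edgeSet ∧ ∀ C ∈ circuits G k, ¬ C ⊆ I := by
  simp [kCircularMatroid]

lemma kCircularMatroid_ground {α β : Type*} {G : Graph α β} {hE : G.edgeSet.Finite} {k : ℕ}
    {hk : 1 ≤ k} : (kCircularMatroid G hE k hk).E = G.edgeSet := rfl

/-- The circuits of `M_k(G)` are exactly the members of `𝒞_k(G)`. -/
theorem kCircularMatroid_isCircuit_iff {α β : Type*} {G : Graph α β} {hE : G.edgeSet.Finite}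
    {k : ℕ} {hk : 1 ≤ k} {C : Set β} :
    (kCircularMatroid G hE k hk).IsCircuit C ↔ C ∈ circuits G k := by
  have key : ∀ D ∈ circuits G k, (kCircularMatroid G hE k hk).IsCircuit D := by
    intro D hD
    rw [Matroid.isCircuit_iff_forall_ssubset, Matroid.Dep, kCircularMatroid_indep_iff,
      kCircularMatroid_ground]
    refine ⟨⟨fun h ↦ h.2 D hD subset_rfl, hD.1⟩, fun I hI ↦ ?_⟩
    have hID : I ⊆ D := hI.subset
    rw [kCircularMatroid_indep_iff]
    refine ⟨hID.trans hD.1, fun C hC hCI ↦ ?_⟩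
    have h := exc_lt_of_ssubset hD.1 (hE.subset hD.1) hD.2.2 (hCI.trans hID)
      (fun h ↦ hI.ne (hID.antisymm (h ▸ hCI)))
    rw [← excess_edgeInduce hD.1, ← excess_edgeInduce hC.1, hD.2.1, hC.2.1] at h
    exact lt_irrefl _ h
  refine ⟨fun h ↦ ?_, key C⟩
  have hdep := h.not_indep
  rw [kCircularMatroid_indep_iff] at hdep
  push Not at hdep
  obtain ⟨D, hD, hDC⟩ := hdep h.subset_ground
  rwa [← (key D hD).eq_of_subset_isCircuit h hDC]

/-- A matroid is connected if it has no loops, no coloops, and every two elements of its ground set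
lie in a common circuit. -/
def MatroidConnected {β : Type*} (M : Matroid β) : Prop :=
  (∀ e ∈ M.E, ¬ M.IsLoop e) ∧ (∀ e ∈ M.E, ¬ M.IsColoop e) ∧
  ∀ e ∈ M.E, ∀ f ∈ M.E, ∃ C, M.IsCircuit C ∧ e ∈ C ∧ f ∈ C

end KCircular

/-!
The excess `|X| - |V(G⟨X⟩)|` is a supermodular function of `X ⊆ E(G)`, and a set is independent in
`M_k(G)` exactly when all of its subsets have excess less than `k`. Hence the rank of `M_k(G)` is at
most `|V(G)| + k - 1`, and supermodularity shows that this bound is attained exactly when `E(G)` has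
at least that many edges and no subset of `E(G)` has excess larger than `Δ G`. The last condition
says that no component of `G` is a tree: removing a tree component raises the excess, whereas the
edge set of any other component has at least the excess of each of its subsets, a property that
supermodularity passes on to unions. Circuits have this property too, so `M_k(G)` has full rank
whenever it has no coloops.

Every edge at `x` brings the new vertex `x` to `G \ x`, so `E(G) \ S(x, G)` is always a flat. Thus
`S(x, G)` is a cocircuit if and only if the rank of this flat, which is the rank of `M_k(G \ x)`, is
one less than `|V(G)| + k - 1`, i.e. if and only if `M_k(G \ x)` has full rank. That `G \ x` has
enough edges for this is the condition `s(x, G) ≤ ρ*_k(G) + 1`.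
-/

namespace KCircular

section Excess

variable {α β : Type*} {G H : Graph α β} {X Y Z : Set β}

lemma exc_le_add_ncard_sdiff (hY : Y.Finite) (hZY : Z ⊆ Y) :
    exc G Y ≤ exc G Z + (Y \ Z).ncard := by
  have hedges := Set.ncard_sdiff_add_ncard_of_subset hZY hY
  have hends := Set.ncard_le_ncard (ends_mono (G := G) hZY) (finite_ends hY)
  simp only [exc]
  omega

lemma exc_le_exc_sdiff_singleton {e : β} {v : α} (hY : Y.Finite) (hev : G.Inc e v)
    (hv : v ∉ ends G (Y \ {e})) : exc G Y ≤ exc G (Y \ {e}) := by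
  by_cases heY : e ∈ Y
  · have hedges := Set.ncard_sdiff_singleton_add_one heY hY
    have hends : (ends G (Y \ {e})).ncard < (ends G Y).ncard :=
      Set.ncard_lt_ncard ⟨ends_mono Set.sdiff_subset, fun h ↦ hv (h ⟨e, heY, hev⟩)⟩
        (finite_ends hY)
    simp only [exc]
    omega
  · rw [Set.sdiff_singleton_eq_self heY]

lemma exc_le_exc_insert {e : β} {v : α} (hY : Y.Finite) (hev : G.Inc e v)
    (hv : v ∈ ends G Y) : exc G Y ≤ exc G (insert e Y) := by
  by_cases heY : e ∈ Y
  · rw [Set.insert_eq_of_mem heY]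
  · obtain ⟨w, hvw⟩ := hev
    have hsub : ends G (insert e Y) ⊆ insert w (ends G Y) := by
      rintro u ⟨f, rfl | hf, hfu⟩
      · rcases hfu.eq_or_eq_of_isLink hvw with rfl | rfl
        exacts [.inr hv, .inl rfl]
      · exact .inr ⟨f, hf, hfu⟩
    have hends := (Set.ncard_le_ncard hsub ((finite_ends hY).insert w)).trans
      (Set.ncard_insert_le w (ends G Y))
    have hedges := Set.ncard_insert_of_notMem heY hY
    simp only [exc]
    omega

lemma exc_le_exc_edgeSet_of_cover (hE : G.edgeSet.Finite)
    (hcover : ∀ e ∈ G.edgeSet, ∃ C ⊆ G.edgeSet, e ∈ C ∧ ∀ Z ⊆ C, exc G Z ≤ exc G C)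
    (hY : Y ⊆ G.edgeSet) : exc G Y ≤ exc G G.edgeSet := by
  obtain ⟨W, -, hW⟩ := (hE.finite_subsets.subset
    (t := {W | W ⊆ G.edgeSet ∧ exc G Y ≤ exc G W}) fun _ h ↦ h.1).exists_le_maximal
      ⟨hY, le_rfl⟩
  obtain ⟨hWE, hYW⟩ := hW.prop
  suffices G.edgeSet ⊆ W from this.antisymm hWE ▸ hYW
  intro e he
  obtain ⟨C, hCE, heC, hC⟩ := hcover e he
  -- By supermodularity, adjoining `C` to the maximal set `W` does not lower the excess.
  have hsuper := exc_supermodular (G := G) (hE.subset hWE) (hE.subset hCE)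
  have hinter := hC (W ∩ C) Set.inter_subset_right
  exact hW.le_of_ge ⟨Set.union_subset hWE hCE, by linarith⟩ Set.subset_union_left (.inr heC)

lemma edgeInduce_le (G : Graph α β) (X : Set β) : edgeInduce G X ≤ G where
  vertexSet_mono := fun _ ⟨_, _, hv⟩ ↦ hv.vertex_mem
  isLink_mono := fun _ _ _ h ↦ (edgeInduce_isLink.1 h).2

lemma ends_subset_vertexSet (G : Graph α β) (X : Set β) : ends G X ⊆ G.vertexSet :=
  fun _ ⟨_, _, hv⟩ ↦ hv.vertex_mem

lemma ends_edgeSet (hiso : ∀ v ∈ G.vertexSet, ∃ e, G.Inc e v) :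
    ends G G.edgeSet = G.vertexSet :=
  (ends_subset_vertexSet G _).antisymm fun v hv ↦ (hiso v hv).imp fun _ h ↦ ⟨h.edge_mem, h⟩

lemma finite_vertexSet_of_exists_inc (hE : G.edgeSet.Finite)
    (hiso : ∀ v ∈ G.vertexSet, ∃ e, G.Inc e v) :
    G.vertexSet.Finite :=
  ends_edgeSet hiso ▸ finite_ends hE

lemma exc_edgeSet_eq_excess (hiso : ∀ v ∈ G.vertexSet, ∃ e, G.Inc e v) :
    exc G G.edgeSet = excess G := by
  rw [exc, excess, ends_edgeSet hiso]

lemma excess_le_exc_edgeSet (hV : G.vertexSet.Finite) : excess G ≤ exc G G.edgeSet := by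
  have := Set.ncard_le_ncard (ends_subset_vertexSet G G.edgeSet) hV
  simp only [excess, exc]
  omega

lemma ends_eq_of_le (hle : H ≤ G) (hX : X ⊆ H.edgeSet) : ends H X = ends G X := by
  ext v
  exact exists_congr fun e ↦ and_congr_right fun he ↦ hle.inc_congr (hX he)

lemma exc_eq_of_le (hle : H ≤ G) (hX : X ⊆ H.edgeSet) : exc H X = exc G X := by
  rw [exc, exc, ends_eq_of_le hle hX]

end Excess

section Components

variable {α β : Type*} {G : Graph α β} {X : Set β}

lemma mem_of_reflTransGen_adj {S : Set α} {u v : α} (hS : ∀ e v w, G.IsLink e v w → v ∈ S → w ∈ S)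
    (hu : u ∈ S) (huv : Relation.ReflTransGen G.Adj u v) : v ∈ S := by
  induction huv with
  | refl => exact hu
  | tail _ hadj ih => exact hS _ _ _ hadj.choose_spec ih

lemma exists_isComponent_of_mem {v : α} (hv : v ∈ G.vertexSet) :
    ∃ K, IsComponent K G ∧ v ∈ K.vertexSet := by
  let W : Set α := {w | Relation.ReflTransGen G.Adj v w}
  have hlink : ∀ e u w, G.IsLink e u w → u ∈ W → w ∈ W := fun e _ _ h hu ↦ hu.tail ⟨e, h⟩
  have hW : W ⊆ G.vertexSet := fun w hw ↦
    mem_of_reflTransGen_adj (fun _ _ _ h _ ↦ h.right_mem) hv hw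
  have hreach : ∀ w ∈ W, Relation.ReflTransGen (G.induce W).Adj v w := by
    intro w hw
    induction hw with
    | refl => exact .refl
    | @tail u w hu hadj ih =>
      obtain ⟨e, he⟩ := hadj
      exact ih.tail ⟨e, he, hu, hlink e u w he hu⟩
  refine ⟨G.induce W, ⟨.mk' (Graph.induce_le hW) ?_, ⟨v, .refl⟩, fun u hu w hw ↦ ?_⟩, .refl⟩
  · rintro e u ⟨w, h⟩ hu
    exact ⟨u, w, h, hu, hlink e u w h hu⟩
  · exact (Std.Symm.symm _ _ (hreach u hu)).trans (hreach w hw)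

lemma Connected.eq_vertexSet_of_forall_isLink {S : Set α} (hG : Connected G) (hne : S.Nonempty)
    (hSV : S ⊆ G.vertexSet) (hS : ∀ e v w, G.IsLink e v w → v ∈ S → w ∈ S) : S = G.vertexSet := by
  obtain ⟨u, hu⟩ := hne
  exact hSV.antisymm fun v hv ↦ mem_of_reflTransGen_adj hS hu (hG.2 u (hSV hu) v hv)

lemma ends_nonempty (hX : X ⊆ G.edgeSet) (hne : X.Nonempty) : (ends G X).Nonempty := by
  obtain ⟨e, he⟩ := hne
  obtain ⟨v, w, h⟩ := G.exists_isLink_of_mem_edgeSet (hX he)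
  exact ⟨v, e, he, h.inc_left⟩

lemma Connected.exc_le_excess (hG : Connected G) (hE : G.edgeSet.Finite) (hX : X ⊆ G.edgeSet)
    (hne : X.Nonempty) : exc G X ≤ excess G := by
  obtain ⟨Y, hXY, hY⟩ := (hE.finite_subsets.subset
    (t := {Y | Y ⊆ G.edgeSet ∧ exc G X ≤ exc G Y}) fun _ h ↦ h.1).exists_le_maximal ⟨hX, le_rfl⟩
  obtain ⟨hYE, hexc⟩ := hY.prop
  have hclosed : ∀ e v, G.Inc e v → v ∈ ends G Y → e ∈ Y := fun e v hev hv ↦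
    hY.le_of_ge ⟨Set.insert_subset hev.edge_mem hYE,
      hexc.trans (exc_le_exc_insert (hE.subset hYE) hev hv)⟩ (Set.subset_insert e Y)
      (Set.mem_insert e Y)
  have hends : ends G Y = G.vertexSet :=
    hG.eq_vertexSet_of_forall_isLink (ends_nonempty hYE (hne.mono hXY)) (ends_subset_vertexSet G Y)
      fun e v w h hv ↦ ⟨e, hclosed e v h.inc_left hv, h.inc_right⟩
  have hYeq : Y = G.edgeSet := by
    refine hYE.antisymm fun e he ↦ ?_
    obtain ⟨v, w, h⟩ := G.exists_isLink_of_mem_edgeSet he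
    exact hclosed e v h.inc_left (hends ▸ h.left_mem)
  rwa [exc, exc, hends, hYeq, ← exc] at hexc

end Components

section Trees

variable {α β : Type*} {G T : Graph α β} {X : Set β}

lemma exists_isLink_of_degree_eq_one {v : α} (hE : G.edgeSet.Finite) (hv : degree G v = 1) :
    ∃ e w, w ≠ v ∧ G.IsLink e v w ∧ ∀ f, G.Inc f v → f = e := by
  have hfin : {e | G.Inc e v}.Finite := hE.subset fun _ h ↦ h.edge_mem
  have hloops : {e | G.IsLoopAt e v} ⊆ {e | G.Inc e v} := fun _ h ↦ h.inc
  have hle := Set.ncard_le_ncard hloops hfin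
  have hsum : {e | G.Inc e v}.ncard + {e | G.IsLoopAt e v}.ncard = 1 := hv
  obtain ⟨e, he⟩ := Set.ncard_eq_one.1 (show {e | G.Inc e v}.ncard = 1 by omega)
  have hno := (Set.ncard_eq_zero (hfin.subset hloops)).1 (by omega)
  obtain ⟨w, hvw⟩ : G.Inc e v := he.ge rfl
  refine ⟨e, w, ?_, hvw, fun f hf ↦ he.le hf⟩
  rintro rfl
  exact hno.le hvw

lemma exists_mem_exc_le_of_degree_eq_one {v : α} (hX : X.Finite) (hXE : X ⊆ G.edgeSet)
    (hv : degree (edgeInduce G X) v = 1) :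
    ∃ e ∈ X, exc G X ≤ exc G (X \ {e}) ∧ exc G {e} < 0 := by
  obtain ⟨e, w, hwv, hlink, huniq⟩ :=
    exists_isLink_of_degree_eq_one ((edgeInduce_edgeSet hXE).symm ▸ hX) hv
  obtain ⟨heX, hlink⟩ := edgeInduce_isLink.1 hlink
  refine ⟨e, heX, exc_le_exc_sdiff_singleton hX hlink.inc_left ?_, ?_⟩
  · rintro ⟨f, hf, hfv⟩
    exact hf.2 (huniq f (edgeInduce_inc.2 ⟨hf.1, hfv⟩))
  · have hpair : {v, w} ⊆ ends G {e} := by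
      rintro u (rfl | rfl)
      exacts [⟨e, rfl, hlink.inc_left⟩, ⟨e, rfl, hlink.inc_right⟩]
    have hcard := Set.ncard_le_ncard hpair (finite_ends (Set.finite_singleton e))
    rw [Set.ncard_pair hwv.symm] at hcard
    rw [exc, Set.ncard_singleton]
    omega

lemma isCactiGraph_edgeInduce (hX : X.Finite) (hleaf : ∀ v, degree (edgeInduce G X) v ≠ 1)
    (hacyclic : ∀ C ≤ G, ¬ IsCycle C) : IsCactiGraph (edgeInduce G X) := by
  refine ⟨fun v ⟨e, heX, hev⟩ hzero ↦ ?_, fun v _ ↦ hleaf v,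
    fun A hA ↦ hacyclic A (hA.1.le.trans (edgeInduce_le G X))⟩
  have hfin : {e | (edgeInduce G X).Inc e v}.Finite :=
    hX.subset fun e he ↦ (edgeInduce_inc.1 he).1
  have hpos := (Set.ncard_pos hfin).2 ⟨e, edgeInduce_inc.2 ⟨heX, hev⟩⟩
  exact hpos.ne' (Nat.add_eq_zero_iff.1 hzero).1

lemma exc_singleton_nonpos {e : β} (he : e ∈ G.edgeSet) : exc G {e} ≤ 0 := by
  have hpos := (Set.ncard_pos (finite_ends (Set.finite_singleton e))).2
    (ends_nonempty (Set.singleton_subset_iff.2 he) (Set.singleton_nonempty e))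
  rw [exc, Set.ncard_singleton]
  omega

lemma exc_neg_of_forall_not_isCycle (hX : X.Finite) (hXE : X ⊆ G.edgeSet) (hne : X.Nonempty)
    (hacyclic : ∀ C ≤ G, ¬ IsCycle C) : exc G X < 0 := by
  induction hn : X.ncard using Nat.strong_induction_on generalizing X with
  | _ n ih =>
    have hrec : ∀ e ∈ X, X \ {e} ≠ ∅ → exc G (X \ {e}) < 0 := fun e he h ↦
      ih _ (hn ▸ Set.ncard_sdiff_singleton_lt_of_mem he hX) (hX.subset Set.sdiff_subset)
        (Set.sdiff_subset.trans hXE) (Set.nonempty_iff_ne_empty.2 h) rfl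
    have hsingle : ∀ e ∈ X, X \ {e} = ∅ → X = {e} := fun e he h ↦
      (Set.sdiff_eq_empty.1 h).antisymm (Set.singleton_subset_iff.2 he)
    by_cases hleaf : ∃ v, degree (edgeInduce G X) v = 1
    · obtain ⟨v, hv⟩ := hleaf
      obtain ⟨e, he, hle, hneg⟩ := exists_mem_exc_le_of_degree_eq_one hX hXE hv
      by_cases h : X \ {e} = ∅
      · rwa [hsingle e he h]
      · exact hle.trans_lt (hrec e he h)
    · obtain ⟨e, he⟩ := hne
      have hpos := exc_lt_of_ssubset hXE hX
        (isCactiGraph_edgeInduce hX (not_exists.1 hleaf) hacyclic) X.empty_subset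
        (Set.nonempty_of_mem he).ne_empty.symm
      rw [exc_empty] at hpos
      by_cases h : X \ {e} = ∅
      · exact absurd (hsingle e he h ▸ hpos) (exc_singleton_nonpos (hXE he)).not_gt
      · have hlip := exc_le_add_ncard_sdiff (G := G) hX (Set.sdiff_subset (s := X) (t := {e}))
        rw [Set.sdiff_sdiff_cancel_left (Set.singleton_subset_iff.2 he),
          Set.ncard_singleton] at hlip
        have := hrec e he h
        omega

lemma IsCycle.exc_nonneg_of_le {C : Graph α β} (hC : IsCycle C) (hle : C ≤ G)
    (hE : G.edgeSet.Finite) (hV : G.vertexSet.Finite) : 0 ≤ exc G C.edgeSet := by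
  have hCV := hV.subset hle.vertexSet_mono
  have hexcess : excess C = 0 :=
    sub_eq_zero.2 (congrArg _ (hC.card_eq (hE.subset hle.edgeSet_mono) hCV))
  rw [← exc_eq_of_le hle subset_rfl, ← hexcess]
  exact excess_le_exc_edgeSet hCV

lemma IsCycle.edgeSet_nonempty {C : Graph α β} (hC : IsCycle C) : C.edgeSet.Nonempty := by
  obtain ⟨v, hv⟩ := hC.1.1
  by_contra! hempty
  have hnone : ∀ e, e ∉ C.edgeSet := fun e he ↦ (hempty ▸ he : e ∈ (∅ : Set β))
  have hinc : {e | C.Inc e v} = ∅ := Set.eq_empty_of_forall_notMem fun e he ↦ hnone e he.edge_mem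
  have hloop : {e | C.IsLoopAt e v} = ∅ :=
    Set.eq_empty_of_forall_notMem fun e he ↦ hnone e he.edge_mem
  simpa [degree, hinc, hloop] using hC.2 v hv

lemma Connected.isTree_iff_excess_neg (hG : Connected G) (hE : G.edgeSet.Finite)
    (hV : G.vertexSet.Finite) : IsTree G ↔ excess G < 0 := by
  constructor
  · rintro ⟨-, hacyclic⟩
    rcases G.edgeSet.eq_empty_or_nonempty with hempty | hne
    · simpa [excess, hempty] using (Set.ncard_pos hV).2 hG.1
    · exact (excess_le_exc_edgeSet hV).trans_lt
        (exc_neg_of_forall_not_isCycle hE subset_rfl hne hacyclic)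
  · intro hneg
    refine ⟨hG, fun C hle hC ↦ hneg.not_ge ?_⟩
    exact (hC.exc_nonneg_of_le hle hE hV).trans
      (hG.exc_le_excess hE hle.edgeSet_mono hC.edgeSet_nonempty)

lemma exists_inc_of_forall_not_isTree (h : ∀ T, IsComponent T G → ¬ IsTree T) :
    ∀ v ∈ G.vertexSet, ∃ e, G.Inc e v := by
  intro v hv
  by_contra! hiso
  have hclosed : (G.induce {v}).IsClosedSubgraph G :=
    .mk' (Graph.induce_le (Set.singleton_subset_iff.2 hv))
      fun e u hinc hu ↦ absurd (hu ▸ hinc) (hiso e)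
  have hconn : Connected (G.induce {v}) :=
    ⟨⟨v, rfl⟩, by rintro u rfl w rfl; exact .refl⟩
  refine h _ ⟨hclosed, hconn⟩ ⟨hconn, fun C hle hC ↦ ?_⟩
  obtain ⟨e, he⟩ := hC.edgeSet_nonempty
  obtain ⟨u, w, hlink⟩ := C.exists_isLink_of_mem_edgeSet he
  obtain ⟨hlink, rfl, -⟩ := hle.isLink_mono hlink
  exact hiso e hlink.inc_left

lemma IsComponent.excess_lt_exc_sdiff (hT : IsComponent T G) (hE : G.edgeSet.Finite)
    (hV : G.vertexSet.Finite) (hneg : excess T < 0) :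
    excess G < exc G (G.edgeSet \ T.edgeSet) := by
  have hends : ends G (G.edgeSet \ T.edgeSet) ⊆ G.vertexSet \ T.vertexSet :=
    fun v ⟨e, he, hev⟩ ↦ ⟨hev.vertex_mem, fun hv ↦ he.2 (hT.1.closed hev hv)⟩
  have hcard := Set.ncard_le_ncard hends (hV.subset Set.sdiff_subset)
  have hedges := Set.ncard_sdiff_add_ncard_of_subset hT.1.le.edgeSet_mono hE
  have hverts := Set.ncard_sdiff_add_ncard_of_subset hT.1.le.vertexSet_mono hV
  simp only [excess, exc] at hneg ⊢
  omega

lemma IsComponent.exc_le_exc_edgeSet {K : Graph α β} (hK : IsComponent K G)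
    (hE : G.edgeSet.Finite) (hV : G.vertexSet.Finite) (hT : ¬ IsTree K) (hX : X ⊆ K.edgeSet) :
    exc G X ≤ exc G K.edgeSet := by
  have hKE := hE.subset hK.1.le.edgeSet_mono
  have hKV := hV.subset hK.1.le.vertexSet_mono
  rw [hK.2.isTree_iff_excess_neg hKE hKV, not_lt] at hT
  rw [← exc_eq_of_le hK.1.le hX, ← exc_eq_of_le hK.1.le subset_rfl]
  refine le_trans ?_ (excess_le_exc_edgeSet hKV)
  rcases X.eq_empty_or_nonempty with rfl | hne
  · rwa [exc_empty]
  · exact hK.2.exc_le_excess hKE hX hne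

lemma forall_not_isTree_iff (hE : G.edgeSet.Finite)
    (hiso : ∀ v ∈ G.vertexSet, ∃ e, G.Inc e v) :
    (∀ T, IsComponent T G → ¬ IsTree T) ↔ ∀ Y ⊆ G.edgeSet, exc G Y ≤ excess G := by
  have hV := finite_vertexSet_of_exists_inc hE hiso
  constructor
  · intro h Y hY
    rw [← exc_edgeSet_eq_excess hiso]
    refine exc_le_exc_edgeSet_of_cover hE (fun e he ↦ ?_) hY
    obtain ⟨v, w, hlink⟩ := G.exists_isLink_of_mem_edgeSet he
    obtain ⟨K, hK, hv⟩ := exists_isComponent_of_mem hlink.left_mem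
    exact ⟨K.edgeSet, hK.1.le.edgeSet_mono, hK.1.closed hlink.inc_left hv,
      fun Z hZ ↦ hK.exc_le_exc_edgeSet hE hV (h K hK) hZ⟩
  · intro h T hT hTree
    have hTE := hE.subset hT.1.le.edgeSet_mono
    have hTV := hV.subset hT.1.le.vertexSet_mono
    exact (hT.excess_lt_exc_sdiff hE hV ((hT.2.isTree_iff_excess_neg hTE hTV).1 hTree)).not_ge
      (h _ Set.sdiff_subset)

end Trees

section Hyperplane

variable {β : Type*} {M : Matroid β} [M.RankFinite] {F : Set β}

lemma not_spanning_iff_eRk_lt (hF : F ⊆ M.E) : ¬ M.Spanning F ↔ M.eRk F < M.eRank := by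
  rw [Matroid.spanning_iff_eRk_le hF, not_le]

lemma eRk_add_one_eq_eRank_of_isCocircuit (hF : F ⊆ M.E) (hK : M.IsCocircuit (M.E \ F)) :
    M.eRk F + 1 = M.eRank := by
  obtain ⟨e, heE, heF⟩ := hK.nonempty
  rw [Matroid.isCocircuit_iff_minimal_compl_nonspanning, Set.minimal_iff_forall_ssubset,
    Set.sdiff_sdiff_cancel_left hF, not_spanning_iff_eRk_lt hF] at hK
  refine le_antisymm (Order.add_one_le_of_lt hK.1) ?_
  have hspan : M.Spanning (insert e F) := by
    have h := not_not.1 (hK.2 (Set.sdiff_singleton_ssubset.2 ⟨heE, heF⟩))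
    rwa [Set.sdiff_sdiff_right, Set.sdiff_sdiff_cancel_left hF,
      Set.inter_eq_self_of_subset_right (Set.singleton_subset_iff.2 heE), Set.union_singleton] at h
  exact hspan.eRk_eq.ge.trans (M.eRk_insert_le_add_one e F)

lemma isCocircuit_sdiff_iff_eRk_add_one_eq (hF : M.IsFlat F) :
    M.IsCocircuit (M.E \ F) ↔ M.eRk F + 1 = M.eRank := by
  have hFE := hF.subset_ground
  refine ⟨eRk_add_one_eq_eRank_of_isCocircuit hFE, fun h ↦ ?_⟩
  rw [Matroid.isCocircuit_iff_minimal_compl_nonspanning, Set.minimal_iff_forall_ssubset,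
    Set.sdiff_sdiff_cancel_left hFE, not_spanning_iff_eRk_lt hFE, ← h]
  have hrank : M.eRk F ≠ ⊤ := (M.isRkFinite_set F).eRk_lt_top.ne
  refine ⟨(ENat.lt_add_one_iff hrank).2 le_rfl, fun X hX ↦ not_not.2 ?_⟩
  obtain ⟨e, ⟨heE, heF⟩, heX⟩ := Set.exists_of_ssubset hX
  rw [Matroid.spanning_iff_eRk_le, ← h,
    ← Matroid.eRk_insert_eq_add_one ⟨heE, hF.closure.symm ▸ heF⟩]
  exact M.eRk_mono (Set.insert_subset ⟨heE, heX⟩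
    fun f hf ↦ ⟨hFE hf, fun hfX ↦ (hX.subset hfX).2 hf⟩)

end Hyperplane

section Rank

variable {α β : Type*} {G : Graph α β} {hE : G.edgeSet.Finite} {k : ℕ} {hk : 1 ≤ k}
  {I B D Y : Set β}

lemma kCircularMatroid_indep_iff_exc_lt :
    (kCircularMatroid G hE k hk).Indep I ↔ I ⊆ G.edgeSet ∧ ∀ Y ⊆ I, exc G Y < k := by
  rw [kCircularMatroid_indep_iff]
  exact and_congr_right fun hI ↦ noCircuit_iff hk hI (hE.subset hI)

instance kCircularMatroid_finite : (kCircularMatroid G hE k hk).Finite := ⟨hE⟩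

lemma exists_add_ncard_le_exc_union (hI : I.Finite) (hlt : ∀ Y ⊆ I, exc G Y < k)
    (hD : D.Finite) (hne : D.Nonempty) (hdisj : Disjoint D I)
    (hspan : ∀ e ∈ D, ∃ C ⊆ insert e I, k ≤ exc G C) :
    ∃ Y ⊆ I ∪ D, k - 1 + D.ncard ≤ exc G Y := by
  induction D, hD using Set.Finite.induction_on with
  | empty => exact absurd hne Set.not_nonempty_empty
  | @insert e D heD hD ih =>
    rw [Set.disjoint_insert_left] at hdisj
    obtain ⟨C, hC, hCk⟩ := hspan e (Set.mem_insert e D)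
    rw [Set.ncard_insert_of_notMem heD hD]
    push_cast
    rcases D.eq_empty_or_nonempty with rfl | hne
    · exact ⟨C, by simpa [Set.union_singleton] using hC, by simpa using hCk⟩
    · obtain ⟨Y, hY, hYk⟩ := ih hne hdisj.2 fun f hf ↦ hspan f (Set.mem_insert_of_mem e hf)
      -- `Y` and `C` meet inside `I`, where the excess is at most `k - 1`, so `Y ∪ C` gains one.
      have hinter : Y ∩ C ⊆ I := by
        rintro f ⟨hfY, hfC⟩
        rcases hY hfY with hfI | hfD
        · exact hfI
        · exact (hC hfC).resolve_left (ne_of_mem_of_not_mem hfD heD)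
      refine ⟨Y ∪ C, ?_, ?_⟩
      · rw [Set.union_insert]
        exact Set.union_subset (hY.trans (Set.subset_insert _ _))
          (hC.trans (Set.insert_subset_insert Set.subset_union_left))
      · have hsuper := exc_supermodular (G := G) ((hI.union hD).subset hY) ((hI.insert e).subset hC)
        have := hlt _ hinter
        omega

lemma exists_add_ncard_le_exc_of_isBase (hB : (kCircularMatroid G hE k hk).IsBase B)
    (hne : (G.edgeSet \ B).Nonempty) :
    ∃ Y ⊆ G.edgeSet, k - 1 + (G.edgeSet \ B).ncard ≤ exc G Y := by
  have hBE : B ⊆ G.edgeSet := hB.subset_ground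
  have hspan : ∀ e ∈ G.edgeSet \ B, ∃ C ⊆ insert e B, k ≤ exc G C := by
    intro e he
    have hdep := (hB.insert_dep he).not_indep
    rw [kCircularMatroid_indep_iff_exc_lt] at hdep
    push Not at hdep
    exact hdep (Set.insert_subset he.1 hBE)
  obtain ⟨Y, hY, hYk⟩ := exists_add_ncard_le_exc_union (hE.subset hBE)
    (kCircularMatroid_indep_iff_exc_lt.1 hB.indep).2 (hE.subset Set.sdiff_subset) hne
    Set.disjoint_sdiff_left hspan
  exact ⟨Y, hY.trans (Set.union_subset hBE Set.sdiff_subset), hYk⟩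

lemma exc_le_of_isBase (hB : (kCircularMatroid G hE k hk).IsBase B) (hY : Y ⊆ G.edgeSet) :
    exc G Y ≤ k - 1 + (G.edgeSet \ B).ncard := by
  have hlip := exc_le_add_ncard_sdiff (G := G) (hE.subset hY) (Set.inter_subset_left (t := B))
  rw [Set.sdiff_self_inter] at hlip
  have hindep := (kCircularMatroid_indep_iff_exc_lt.1 hB.indep).2 _
    (Set.inter_subset_right (s := Y))
  have hcard := Set.ncard_le_ncard (Set.sdiff_subset_sdiff_left (t := B) hY)
    (hE.subset Set.sdiff_subset)
  omega

/-- `M_k(G)` has full rank if its rank is `|V(G)| + k - 1`, the largest value that `V(G)` and `k`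
allow. The equation is written additively since subtraction in `ℕ∞` is truncated. -/
def HasFullRank (G : Graph α β) (hE : G.edgeSet.Finite) (k : ℕ) (hk : 1 ≤ k) : Prop :=
  (kCircularMatroid G hE k hk).eRank + 1 = G.vertexSet.encard + k

lemma HasFullRank.exists_inc (h : HasFullRank G hE k hk) :
    ∀ v ∈ G.vertexSet, ∃ e, G.Inc e v := by
  obtain ⟨B, hB⟩ := (kCircularMatroid G hE k hk).exists_isBase
  have hBf : B.Finite := hE.subset hB.subset_ground
  have hexc := (kCircularMatroid_indep_iff_exc_lt.1 hB.indep).2 B subset_rfl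
  rw [HasFullRank, ← hB.encard_eq_eRank, ← hBf.cast_ncard_eq] at h
  have hV : G.vertexSet.Finite := by
    by_contra hinf
    rw [Set.not_finite.1 hinf |>.encard_eq, top_add] at h
    exact ENat.natCast_ne_top (B.ncard + 1) (by exact_mod_cast h)
  rw [← hV.cast_ncard_eq] at h
  norm_cast at h
  have hends : ends G B = G.vertexSet :=
    Set.eq_of_subset_of_ncard_le (ends_subset_vertexSet G B) (by rw [exc] at hexc; omega) hV
  exact fun v hv ↦ (hends.ge hv).imp fun _ h ↦ h.2

lemma hasFullRank_iff_ncard_add_one_eq (hV : G.vertexSet.Finite)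
    (hB : (kCircularMatroid G hE k hk).IsBase B) :
    HasFullRank G hE k hk ↔ B.ncard + 1 = G.vertexSet.ncard + k := by
  rw [HasFullRank, ← hB.encard_eq_eRank, ← (hE.subset hB.subset_ground).cast_ncard_eq,
    ← hV.cast_ncard_eq]
  norm_cast

lemma hasFullRank_iff_forall_exc_le (hiso : ∀ v ∈ G.vertexSet, ∃ e, G.Inc e v) :
    HasFullRank G hE k hk ↔
      k ≤ excess G + 1 ∧ ∀ Y ⊆ G.edgeSet, exc G Y ≤ excess G := by
  obtain ⟨B, hB⟩ := (kCircularMatroid G hE k hk).exists_isBase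
  have hBE : B ⊆ G.edgeSet := hB.subset_ground
  have hedges := Set.ncard_sdiff_add_ncard_of_subset hBE hE
  have hexcess : excess G = G.edgeSet.ncard - G.vertexSet.ncard := rfl
  rw [hasFullRank_iff_ncard_add_one_eq (finite_vertexSet_of_exists_inc hE hiso) hB]
  constructor
  · intro h
    refine ⟨by omega, fun Y hY ↦ ?_⟩
    have := exc_le_of_isBase hB hY
    omega
  · rintro ⟨hk, hmax⟩
    have hupper := exc_le_of_isBase hB subset_rfl
    rw [exc_edgeSet_eq_excess hiso] at hupper
    rcases (G.edgeSet \ B).eq_empty_or_nonempty with hempty | hne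
    · rw [hempty, Set.ncard_empty] at hedges hupper
      omega
    · obtain ⟨Y, hY, hlower⟩ := exists_add_ncard_le_exc_of_isBase hB hne
      have := hmax Y hY
      omega

lemma hasFullRank_iff_forall_not_isTree :
    HasFullRank G hE k hk ↔
      k ≤ excess G + 1 ∧ ∀ T, IsComponent T G → ¬ IsTree T := by
  constructor
  · intro h
    rwa [forall_not_isTree_iff hE h.exists_inc, ← hasFullRank_iff_forall_exc_le h.exists_inc]
  · intro h
    have hiso := exists_inc_of_forall_not_isTree h.2
    rwa [hasFullRank_iff_forall_exc_le hiso, ← forall_not_isTree_iff hE hiso]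

lemma hasFullRank_of_forall_not_isColoop (hiso : ∀ v ∈ G.vertexSet, ∃ e, G.Inc e v)
    (hne : G.edgeSet.Nonempty)
    (hcoloop : ∀ e ∈ G.edgeSet, ¬ (kCircularMatroid G hE k hk).IsColoop e) :
    HasFullRank G hE k hk := by
  have hcircuit : ∀ e ∈ G.edgeSet, ∃ C ∈ circuits G k, e ∈ C := by
    intro e he
    obtain ⟨C, hC, heC⟩ := Matroid.exists_mem_isCircuit_of_not_isColoop he (hcoloop e he)
    exact ⟨C, kCircularMatroid_isCircuit_iff.1 hC, heC⟩
  have hmax : ∀ Y ⊆ G.edgeSet, exc G Y ≤ excess G := by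
    intro Y hY
    rw [← exc_edgeSet_eq_excess hiso]
    refine exc_le_exc_edgeSet_of_cover hE (fun e he ↦ ?_) hY
    obtain ⟨C, ⟨hCE, -, hcacti⟩, heC⟩ := hcircuit e he
    refine ⟨C, hCE, heC, fun Z hZ ↦ ?_⟩
    rcases eq_or_ne Z C with rfl | hZC
    exacts [le_rfl, (exc_lt_of_ssubset hCE (hE.subset hCE) hcacti hZ hZC).le]
  refine (hasFullRank_iff_forall_exc_le hiso).2 ⟨?_, hmax⟩
  obtain ⟨e, he⟩ := hne
  obtain ⟨C, ⟨hCE, hCk, -⟩, -⟩ := hcircuit e he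
  rw [excess_edgeInduce hCE] at hCk
  have := hmax C hCE
  omega

end Rank

section Deletion

variable {α β : Type*} {G H : Graph α β} {hE : G.edgeSet.Finite} {k : ℕ} {hk : 1 ≤ k}

lemma kCircularMatroid_restrict_edgeSet (hle : H ≤ G) :
    (kCircularMatroid G hE k hk).restrict H.edgeSet =
      kCircularMatroid H (hE.subset hle.edgeSet_mono) k hk := by
  refine Matroid.ext_indep rfl fun I hI ↦ ?_
  have hIH : I ⊆ H.edgeSet := hI
  simp only [Matroid.restrict_indep_iff, kCircularMatroid_indep_iff_exc_lt, hIH,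
    hIH.trans hle.edgeSet_mono, true_and, and_true]
  exact forall₂_congr fun Y hY ↦ by rw [exc_eq_of_le hle (hY.trans hIH)]

lemma isFlat_edgeSet_of_isInducedSubgraph (h : H.IsInducedSubgraph G) :
    (kCircularMatroid G hE k hk).IsFlat H.edgeSet := by
  refine ⟨fun I X hIH hIX e heX ↦ ?_, h.le.edgeSet_mono⟩
  by_contra heH
  have heE : e ∈ G.edgeSet := hIX.subset_ground heX
  -- The new end `v` of `e` offsets the new edge, so adding `e` to `I` does not raise the excess.
  obtain ⟨v, hev, hv⟩ : ∃ v, G.Inc e v ∧ v ∉ H.vertexSet := by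
    obtain ⟨u, w, hlink⟩ := G.exists_isLink_of_mem_edgeSet heE
    by_contra! hends
    have hlinkH := h.isLink_of_mem_mem hlink (hends u hlink.inc_left) (hends w hlink.inc_right)
    exact heH hlinkH.edge_mem
  have hI := kCircularMatroid_indep_iff_exc_lt.1 hIH.indep
  refine heH (hIH.subset (hIX.mem_of_insert_indep heX ?_))
  refine kCircularMatroid_indep_iff_exc_lt.2 ⟨Set.insert_subset heE hI.1, fun Y hY ↦ ?_⟩
  have hYI : Y \ {e} ⊆ I := Set.sdiff_singleton_subset_iff.2 hY
  have hYfin : Y.Finite := hE.subset (hY.trans (Set.insert_subset heE hI.1))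
  refine (exc_le_exc_sdiff_singleton hYfin hev ?_).trans_lt (hI.2 _ hYI)
  rw [← ends_eq_of_le h.le (hYI.trans hIH.subset)]
  exact fun hv' ↦ hv (ends_subset_vertexSet H _ hv')

lemma isCocircuit_sdiff_edgeSet_iff (h : H.IsInducedSubgraph G) :
    (kCircularMatroid G hE k hk).IsCocircuit (G.edgeSet \ H.edgeSet) ↔
      (kCircularMatroid H (hE.subset h.le.edgeSet_mono) k hk).eRank + 1 =
        (kCircularMatroid G hE k hk).eRank := by
  rw [← kCircularMatroid_restrict_edgeSet h.le, Matroid.eRank_restrict]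
  exact isCocircuit_sdiff_iff_eRk_add_one_eq (isFlat_edgeSet_of_isInducedSubgraph h)

lemma deleteVerts_isInducedSubgraph (G : Graph α β) (S : Set α) :
    (G.deleteVerts S).IsInducedSubgraph G where
  le := Graph.deleteVerts_le
  isLink_of_mem_mem _ _ _ hlink hu hv := ⟨hlink, hu, hv⟩

lemma edgeSet_sdiff_edgeSet_deleteVerts (G : Graph α β) (x : α) :
    G.edgeSet \ (G.deleteVerts {x}).edgeSet = star G x := by
  ext e
  constructor
  · rintro ⟨he, hex⟩
    obtain ⟨u, w, hlink⟩ := G.exists_isLink_of_mem_edgeSet he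
    by_contra hstar
    rw [Graph.edgeSet_deleteVerts] at hex
    refine hex ⟨u, w, hlink, ?_, ?_⟩
    · rintro rfl
      exact hstar hlink.inc_left
    · rintro rfl
      exact hstar hlink.inc_right
  · refine fun hex ↦ ⟨Graph.Inc.edge_mem hex, fun he ↦ ?_⟩
    have hx := ((Graph.deleteVerts_le (G := G) (X := {x})).inc_congr he).2 hex
    exact hx.vertex_mem.2 rfl

lemma HasFullRank.deleteVerts_iff_eRank_add_one_eq {x : α} (h : HasFullRank G hE k hk)
    (hx : x ∈ G.vertexSet) (hE' : (G.deleteVerts {x}).edgeSet.Finite) :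
    HasFullRank (G.deleteVerts {x}) hE' k hk ↔
      (kCircularMatroid (G.deleteVerts {x}) hE' k hk).eRank + 1 =
        (kCircularMatroid G hE k hk).eRank := by
  have hcancel (m n : ℕ∞) : m + 1 = n + 1 ↔ m = n :=
    (ENat.add_left_injective_of_ne_top ENat.one_ne_top).eq_iff
  rw [HasFullRank, ← Set.encard_sdiff_singleton_add_one hx, add_right_comm] at h
  rw [HasFullRank, Graph.vertexSet_deleteVerts, ← hcancel, ← h, hcancel]

lemma HasFullRank.le_excess_deleteVerts_add_one_iff {x : α} (h : HasFullRank G hE k hk)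
    (hx : x ∈ G.vertexSet) :
    k ≤ excess (G.deleteVerts {x}) + 1 ↔
      (star G x).encard ≤ (kCircularMatroid G hE k hk)✶.eRank + 1 := by
  obtain ⟨B, hB⟩ := (kCircularMatroid G hE k hk).exists_isBase
  have hV := finite_vertexSet_of_exists_inc hE h.exists_inc
  have hstar : (star G x).Finite := hE.subset fun _ he ↦ Graph.Inc.edge_mem he
  have hcobase : (kCircularMatroid G hE k hk)✶.IsBase (G.edgeSet \ B) := hB.compl_isBase_dual
  have hB_card := (hasFullRank_iff_ncard_add_one_eq hV hB).1 h
  have hB_compl := Set.ncard_sdiff_add_ncard_of_subset hB.subset_ground hE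
  have hverts := Set.ncard_sdiff_singleton_add_one hx hV
  have hedges := Set.ncard_sdiff_add_ncard_of_subset
    (Graph.deleteVerts_le (G := G) (X := {x})).edgeSet_mono hE
  rw [edgeSet_sdiff_edgeSet_deleteVerts] at hedges
  rw [kCircularMatroid_ground] at hB_compl
  rw [← hcobase.encard_eq_eRank, ← hstar.cast_ncard_eq,
    ← (hE.subset Set.sdiff_subset).cast_ncard_eq, excess, Graph.vertexSet_deleteVerts,
    ← Nat.cast_add_one, Nat.cast_le]
  omega

end Deletion

end KCircular

theorem mainTheorem6_general {α β : Type*} (G : Graph α β) (hE : G.edgeSet.Finite)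
    (k : ℕ) (hk : 1 ≤ k) (x : α) (hx : x ∈ G.vertexSet)
    (hfull : KCircular.HasFullRank G hE k hk) :
    (KCircular.kCircularMatroid G hE k hk).IsCocircuit (KCircular.star G x) ↔
      (KCircular.star G x).encard ≤ (KCircular.kCircularMatroid G hE k hk)✶.eRank + 1 ∧
        ∀ T, KCircular.IsComponent T (G.deleteVerts {x}) → ¬ KCircular.IsTree T := by
  rw [← KCircular.edgeSet_sdiff_edgeSet_deleteVerts,
    KCircular.isCocircuit_sdiff_edgeSet_iff (KCircular.deleteVerts_isInducedSubgraph G {x}),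
    ← hfull.deleteVerts_iff_eRank_add_one_eq hx, KCircular.hasFullRank_iff_forall_not_isTree,
    hfull.le_excess_deleteVerts_add_one_iff hx, KCircular.edgeSet_sdiff_edgeSet_deleteVerts]

theorem mainTheorem6 {α β : Type*} (G : Graph α β)
    (hV : G.vertexSet.Finite) (hE : G.edgeSet.Finite)
    (hiso : ∀ v ∈ G.vertexSet, ∃ e, G.Inc e v)
    (k : ℕ) (hk : 1 ≤ k)
    (hconn : KCircular.MatroidConnected (KCircular.kCircularMatroid G hE k hk))
    (x : α) (hx : x ∈ G.vertexSet)
    (hs : (KCircular.star G x).encard ≤ (KCircular.kCircularMatroid G hE k hk)✶.eRank + 1) :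
    (KCircular.kCircularMatroid G hE k hk).IsCocircuit (KCircular.star G x) ↔
      ∀ T, KCircular.IsComponent T (G.deleteVerts {x}) → ¬ KCircular.IsTree T := by
  obtain ⟨e, he⟩ := hiso x hx
  have hfull := KCircular.hasFullRank_of_forall_not_isColoop hiso ⟨e, he.edge_mem⟩ hconn.2.1
  exact (mainTheorem6_general G hE k hk x hx hfull).trans (and_iff_right hs)
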